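/- Let $Z$ be a finite set labelling the computational basis $\{|z\rangle\}_{z\in Z}$ of $\mathbb{C}^Z$, let $M\ge 0$, $K\ge 0$ be integers, and let $H(t)=H_0+V(t)$, where $H_0$ is diagonal with real diagonal entries $E_z=\langle z|H_0|z\rangle$ and $$V(t)=\sum_{i=0}^{M}D_i(t)P_i,\qquad D_i(t)=\sum_{k=1}^{K}\exp\bigl(\Lambda_i^{(k)}t\bigr)D_i^{(k)},$$ with $P_0,\dots,P_M$ permutation operators of the basis and $\Lambda_i^{(k)},D_i^{(k)}$ complex diagonal matrices with entries $\lambda_{i,z}^{(k)}=\langle z|\Lambda_i^{(k)}|z\rangle$, $d_{i,z}^{(k)}=\langle z|D_i^{(k)}|z\rangle$. Put $H_I(t)=e^{iH_0t}V(t)e^{-iH_0t}$ and let $$U_I(t,s)=\mathcal{T}\exp\Bigl[-i\int_s^tH_I(\tau)\,d\tau\Bigr]=\sum_{q=0}^\infty(-i)^q\int_s^t d\tau_q\cdots\int_s^{\tau_2}d\tau_1\,H_I(\tau_q)\cdots H_I(\tau_1)$$ be the interaction-picture evolution operator. Let $t_w,\Delta t_w\in\mathbb{R}$. Then $U_I(\cdot,t_w)$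 is indeed the evolution generated by $H_I$: $U_I(t_w,t_w)=\mathbb{1}$ and $\frac{d}{dt}U_I(t,t_w)|\psi\rangle=-iH_I(t)U_I(t,t_w)|\psi\rangle$ for every vector $|\psi\rangle$ and every $t\in\mathbb{R}$. Moreover, for every $z\in Z$, $$U_I(t_w+\Delta t_w,t_w)|z\rangle=\sum_{q=0}^{\infty}\ \sum_{\mathbf{i}_q}\sum_{\mathbf{k}_q}(-i)^q\,e^{-it_w\left(E_{z}-E_{z_{\mathbf{i}_q}}\right)}\,e^{\Delta t_w[x_1,\dots,x_q,0]}\,d_{\mathbf{i}_q,z}^{(\mathbf{k}_q)}(t_w)\,P_{\mathbf{i}_q}|z\rangle ,$$ where the series over $q$ converges. Here the finite inner sums run over all multi-indices $\mathbf{i}_q=(i_q,\dots,i_1)\in\{0,\dots,M\}^q$ and $\mathbf{k}_q=(k_q,\dots,k_1)\in\{1,\dots,K\}^q$; $P_{\mathbf{i}_j}=P_{i_j}\cdots P_{i_1}$ and $|z_{\mathbf{i}_j}\rangle=P_{\mathbf{i}_j}|z\rangle$ for $0\le j\le q$, with $z_{\mathbf{i}_0}=z$; $$d_{\mathbf{i}_q,z}^{(\mathbf{k}_q)}(t_w)=\Bigl(\prod_{l=1}^q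 d^{(k_l)}_{i_l,z_{\mathbf{i}_l}}\Bigr)\exp\Bigl(t_w\sum_{l=1}^q\lambda^{(k_l)}_{i_l,z_{\mathbf{i}_l}}\Bigr),\qquad x_j=i\bigl(E_{z_{\mathbf{i}_q}}-E_{z_{\mathbf{i}_{j-1}}}\bigr)+\sum_{l=j}^q\lambda^{(k_l)}_{i_l,z_{\mathbf{i}_l}}\quad(1\le j\le q);$$ and $e^{t[x_1,\dots,x_q,0]}$ is the divided difference $f[x_1,\dots,x_q,0]$ of the function $f(x)=e^{tx}$. The divided difference of an analytic $f$ is defined recursively: $f[y_0,\dots,y_q]=f^{(q)}(y_0)/q!$ if all $y_j$ coincide, and otherwise, for any choice of two different entries $a\ne b$ among them, it is the difference of the divided difference of the remaining entries after deleting one copy of $a$ and the one after deleting one copy of $b$, divided by $b-a$. -/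

import Mathlib

open scoped Matrix

noncomputable section

namespace PermExpansion

/-- The divided difference `f[x₀, …, x_q]` of a complex function. If all inputs coincide, it is
`f^{(q)}(x₀) / q!`. Otherwise two different inputs `a`, `b` are singled out and the difference
quotient of the two divided differences that omit `a` and `b` respectively is taken:
`(f[all but a] - f[all but b]) / (b - a)`. Here `a` is the head of the list and `b` some other
entry; for analytic `f` the value does not depend on these choices.
The value at the empty list is a convention that is never used. -/
def dividedDifference (f : ℂ → ℂ) : List ℂ → ℂ
  | [] => 0
  | a :: l =>
    open Classical in
    if h : ∃ b ∈ l, b ≠ a then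
      (dividedDifference f l - dividedDifference f (a :: l.erase h.choose)) / (h.choose - a)
    else
      iteratedDeriv l.length f a / (l.length.factorial : ℂ)
  termination_by l => l.length
  decreasing_by
    · simp
    · have hm := List.length_erase_of_mem h.choose_spec.1
      have hp := List.length_pos_of_mem h.choose_spec.1
      simp only [List.length_cons, hm]
      omega

/-- `e^{t[x₀, …, x_q]}`, the divided difference of the function `x ↦ e^{t x}`. -/
def expDividedDifference (t : ℝ) (x : List ℂ) : ℂ :=
  dividedDifference (fun y => Complex.exp (t * y)) x

/-- The permutation operator of `σ`, characterised by `|z⟩ ↦ |σ z⟩`. -/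
def permOp {Z : Type*} [DecidableEq Z] (σ : Equiv.Perm Z) : Matrix Z Z ℂ :=
  Matrix.of fun x y => if x = σ y then 1 else 0

/-- The computational basis vector `|z⟩`. -/
def ket {Z : Type*} [DecidableEq Z] (z : Z) : Z → ℂ := Pi.single z 1

/-- The nested integral
`∫_s^t dτ_q ∫_s^{τ_q} dτ_{q-1} ⋯ ∫_s^{τ_2} dτ_1 A(τ_q) ⋯ A(τ_1)`, taken entry by entry. -/
def dysonIntegral {Z : Type*} [Fintype Z] [DecidableEq Z] (A : ℝ → Matrix Z Z ℂ) (s : ℝ) :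
    ℕ → ℝ → Matrix Z Z ℂ
  | 0, _ => 1
  | q + 1, t => Matrix.of fun x y => ∫ τ in s..t, (A τ * dysonIntegral A s q τ) x y

/-- The time-ordered exponential `𝒯 exp[-i ∫_s^t A(τ) dτ]`, as a Dyson series. -/
def timeOrderedExp {Z : Type*} [Fintype Z] [DecidableEq Z] (A : ℝ → Matrix Z Z ℂ) (t s : ℝ) :
    Matrix Z Z ℂ :=
  ∑' q : ℕ, (-Complex.I) ^ q • dysonIntegral A s q t

/-- The data of a Hamiltonian `H(t) = H₀ + ∑_{i=0}^M D_i(t) P_i` on the space with basis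
`{|z⟩}_{z ∈ Z}`, with `D_i(t) = ∑_{k=1}^K exp(Λ_i^{(k)} t) D_i^{(k)}`. -/
structure ExpSumHamiltonian (Z : Type*) (M K : ℕ) where
  /-- the (real) diagonal entries `E_z` of `H₀` -/
  E : Z → ℝ
  /-- the permutations `P_i` of the basis -/
  P : Fin (M + 1) → Equiv.Perm Z
  /-- the diagonal entries `λ_{i,z}^{(k)}` of `Λ_i^{(k)}` -/
  lam : Fin (M + 1) → Fin K → Z → ℂ
  /-- the diagonal entries `d_{i,z}^{(k)}` of `D_i^{(k)}` -/
  d : Fin (M + 1) → Fin K → Z → ℂ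

namespace ExpSumHamiltonian

variable {Z : Type*} [Fintype Z] [DecidableEq Z] {M K : ℕ} (H : ExpSumHamiltonian Z M K)

/-- The static diagonal part `H₀`. -/
def H0 : Matrix Z Z ℂ := Matrix.diagonal fun z => (H.E z : ℂ)

/-- `D_i(t) = ∑_k exp(Λ_i^{(k)} t) D_i^{(k)}`. -/
def D (i : Fin (M + 1)) (t : ℝ) : Matrix Z Z ℂ :=
  ∑ k : Fin K,
    NormedSpace.exp ((t : ℂ) • Matrix.diagonal (H.lam i k)) * Matrix.diagonal (H.d i k)

/-- The dynamical part `V(t) = ∑_i D_i(t) P_i`. -/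
def V (t : ℝ) : Matrix Z Z ℂ := ∑ i : Fin (M + 1), H.D i t * permOp (H.P i)

/-- The interaction-picture Hamiltonian `H_I(t) = e^{i H₀ t} V(t) e^{-i H₀ t}`. -/
def HI (t : ℝ) : Matrix Z Z ℂ :=
  NormedSpace.exp ((Complex.I * t) • H.H0) * H.V t *
    NormedSpace.exp ((-Complex.I * t) • H.H0)

/-- The interaction-picture evolution `U_I(t, s) = 𝒯 exp[-i ∫_s^t H_I(τ) dτ]`. -/
def UI (t s : ℝ) : Matrix Z Z ℂ := timeOrderedExp H.HI t s

/-- For the multi-indices `𝐢 = (i_1, …, i_q)`, `𝐤 = (k_1, …, k_q)` (position `l : Fin q` holds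
`i_{l+1}`, `k_{l+1}`): the basis label `z_{𝐢_j}` reached from `z` after `j` steps, that is
`|z_{𝐢_j}⟩ = P_{i_j} ⋯ P_{i_1} |z⟩`, with `z_{𝐢_0} = z`. -/
def label {q : ℕ} (i : Fin q → Fin (M + 1)) (z : Z) (j : ℕ) : Z :=
  ((List.ofFn i).take j).foldl (fun y a => H.P a y) z

/-- The operator `P_{𝐢_q} = P_{i_q} ⋯ P_{i_1}`. -/
def opWord {q : ℕ} (i : Fin q → Fin (M + 1)) : Matrix Z Z ℂ :=
  ((List.ofFn fun l => permOp (H.P (i l))).reverse).prod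

/-- `λ^{(k_l)}_{i_l, z_{𝐢_l}}`. -/
def lamAt {q : ℕ} (i : Fin q → Fin (M + 1)) (k : Fin q → Fin K) (z : Z) (l : Fin q) : ℂ :=
  H.lam (i l) (k l) (H.label i z (l + 1))

/-- `d_{𝐢_q,z}^{(𝐤_q)} = d_{i_q, z_{𝐢_q}}^{(k_q)} ⋯ d_{i_1, z_{𝐢_1}}^{(k_1)}`. -/
def dWord {q : ℕ} (i : Fin q → Fin (M + 1)) (k : Fin q → Fin K) (z : Z) : ℂ :=
  ∏ l : Fin q, H.d (i l) (k l) (H.label i z (l + 1))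

/-- `d_{𝐢_q,z}^{(𝐤_q)}(t) = d_{𝐢_q,z}^{(𝐤_q)} exp(t ∑_{l=1}^q λ^{(k_l)}_{i_l, z_{𝐢_l}})`. -/
def dWordAt {q : ℕ} (i : Fin q → Fin (M + 1)) (k : Fin q → Fin K) (z : Z) (t : ℝ) : ℂ :=
  H.dWord i k z * Complex.exp (t * ∑ l : Fin q, H.lamAt i k z l)

/-- The inputs `x_j = i (E_{z_{𝐢_q}} - E_{z_{𝐢_{j-1}}}) + ∑_{l=j}^q λ^{(k_l)}_{i_l, z_{𝐢_l}}`;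
position `j : Fin q` holds `x_{j+1}`. -/
def input {q : ℕ} (i : Fin q → Fin (M + 1)) (k : Fin q → Fin K) (z : Z) (j : Fin q) : ℂ :=
  Complex.I * ((H.E (H.label i z q) : ℂ) - H.E (H.label i z j)) +
    ∑ l ∈ Finset.univ.filter (fun l : Fin q => j ≤ l), H.lamAt i k z l

end ExpSumHamiltonian

end PermExpansion

end

/-! ### Divided differences of the exponential as iterated convolutions. -/

namespace PermExpansion

/-! Each matrix element of `H_I(τ)` is a sum of terms `d e^{τ r}`, so a Dyson integral applied to
`|z⟩` is a sum over words of nested integrals of exponentials. Such integrals are divided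
differences of `x ↦ e^{tx}`: both sides satisfy the linear ODE hierarchy `F_{a::l}' = a F_{a::l} +
F_l`, from which the divided-difference recursion follows by uniqueness (`sub_mul_expConvolution`,
`expDividedDifference_eq_expConvolution`). Two rules drive the induction on `q`: appending the input
`0` integrates in `t`, and translating all inputs by `r` multiplies by `e^{tr}`. One more factor of
`H_I` does exactly these two things (`ofFn_input_snoc`, `coeff_snoc`). Convergence and the evolution
equation hold for any continuous generator, by the factorial bound `norm_dysonIntegral_le`. -/

/-- The iterated convolution of the exponentials `t ↦ e^{t a}`, for `a` in a list. -/
noncomputable def expConvolution : List ℂ → ℝ → ℂ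
  | [], _ => 0
  | a :: l, t => Complex.exp (t * a) *
      -- The indicator is the value at `t = 0`: only a single exponential starts at `1`.
      ((if l = [] then 1 else 0) + ∫ s in (0 : ℝ)..t, Complex.exp (-(s * a)) * expConvolution l s)

theorem expConvolution_cons (a : ℂ) (l : List ℂ) (t : ℝ) :
    expConvolution (a :: l) t = Complex.exp (t * a) *
      ((if l = [] then 1 else 0) +
        ∫ s in (0 : ℝ)..t, Complex.exp (-(s * a)) * expConvolution l s) := rfl

theorem expConvolution_singleton (a : ℂ) (t : ℝ) :
    expConvolution [a] t = Complex.exp (t * a) := by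
  simp [expConvolution]

theorem expConvolution_cons_zero (a : ℂ) (l : List ℂ) :
    expConvolution (a :: l) 0 = if l = [] then 1 else 0 := by
  simp [expConvolution_cons]

theorem hasDerivAt_cexp_ofReal_mul (a : ℂ) (t : ℝ) :
    HasDerivAt (fun s : ℝ => Complex.exp (s * a)) (Complex.exp (t * a) * a) t := by
  simpa using ((Complex.ofRealCLM.hasDerivAt (x := t)).mul_const a).cexp

theorem hasDerivAt_expConvolution_cons_of_continuous (a : ℂ) {l : List ℂ}
    (hl : Continuous (expConvolution l)) (t : ℝ) :
    HasDerivAt (expConvolution (a :: l))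
      (a * expConvolution (a :: l) t + expConvolution l t) t := by
  have hc : Continuous fun s : ℝ => Complex.exp (-(s * a)) * expConvolution l s := by fun_prop
  have h := (hasDerivAt_cexp_ofReal_mul a t).mul
    ((intervalIntegral.integral_hasDerivAt_right (hc.intervalIntegrable 0 t)
      (hc.stronglyMeasurableAtFilter _ _) hc.continuousAt).const_add (if l = [] then (1 : ℂ) else 0))
  refine h.congr_deriv ?_
  rw [← mul_assoc (Complex.exp _), ← Complex.exp_add, add_neg_cancel, Complex.exp_zero,
    expConvolution_cons]
  ring

theorem continuous_expConvolution (l : List ℂ) : Continuous (expConvolution l) := by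
  induction l with
  | nil => exact continuous_const
  | cons a l ih =>
    exact continuous_iff_continuousAt.2 fun t =>
      (hasDerivAt_expConvolution_cons_of_continuous a ih t).continuousAt

theorem hasDerivAt_expConvolution_cons (a : ℂ) (l : List ℂ) (t : ℝ) :
    HasDerivAt (expConvolution (a :: l))
      (a * expConvolution (a :: l) t + expConvolution l t) t :=
  hasDerivAt_expConvolution_cons_of_continuous a (continuous_expConvolution l) t

/-- A solution of `w' = a w` that vanishes at `0` vanishes identically. -/
theorem eq_zero_of_hasDerivAt_mul {w : ℝ → ℂ} {a : ℂ} (h : ∀ t, HasDerivAt w (a * w t) t)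
    (h0 : w 0 = 0) (t : ℝ) : w t = 0 := by
  have hd : ∀ s : ℝ, HasDerivAt (fun s : ℝ => Complex.exp (s * -a) * w s) 0 s := fun s =>
    ((hasDerivAt_cexp_ofReal_mul (-a) s).mul (h s)).congr_deriv (by ring)
  have hconst := is_const_of_deriv_eq_zero (fun s => (hd s).differentiableAt)
    (fun s => (hd s).deriv) t 0
  simpa [h0, Complex.exp_ne_zero] using hconst

/-- The difference of the two sides solves `w' = a w` and vanishes at `0`, since the sources
`expConvolution l` cancel. -/
theorem sub_mul_expConvolution (a b : ℂ) (l : List ℂ) (t : ℝ) :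
    (b - a) * expConvolution (a :: b :: l) t =
      expConvolution (b :: l) t - expConvolution (a :: l) t := by
  have h := eq_zero_of_hasDerivAt_mul (a := a)
    (w := fun t => expConvolution (b :: l) t - expConvolution (a :: l) t -
      (b - a) * expConvolution (a :: b :: l) t) (fun t =>
      (((hasDerivAt_expConvolution_cons b l t).sub (hasDerivAt_expConvolution_cons a l t)).sub
        ((hasDerivAt_expConvolution_cons a (b :: l) t).const_mul (b - a))).congr_deriv (by ring))
    (by simp [expConvolution_cons_zero]) t
  exact (sub_eq_zero.1 h).symm

/-- For distinct neighbours, `sub_mul_expConvolution` is antisymmetric in `a`, `b` on both sides, so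
the factor `b - a` can be divided out. -/
theorem expConvolution_perm {l l' : List ℂ} (h : l.Perm l') :
    expConvolution l = expConvolution l' := by
  induction h with
  | nil => rfl
  | cons a h ih =>
    funext t
    have : ∀ {m m' : List ℂ}, m.Perm m' → (m = [] ↔ m' = []) := fun h =>
      ⟨fun e => by subst e; exact List.nil_perm.1 h, fun e => by subst e; exact List.perm_nil.1 h⟩
    simp only [expConvolution_cons, ih, this h]
  | swap a b l =>
    funext t
    by_cases hab : a = b
    · rw [hab]
    · refine mul_left_cancel₀ (sub_ne_zero.2 hab) ?_
      rw [sub_mul_expConvolution, ← neg_sub b a, neg_mul, sub_mul_expConvolution, neg_sub]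
  | trans _ _ ih₁ ih₂ => exact ih₁.trans ih₂

theorem expConvolution_replicate (a : ℂ) (n : ℕ) (t : ℝ) :
    expConvolution (List.replicate (n + 1) a) t =
      t ^ n / (n.factorial : ℂ) * Complex.exp (t * a) := by
  induction n generalizing t with
  | zero => simp [expConvolution_singleton]
  | succ n ih =>
    rw [List.replicate_succ, expConvolution_cons, if_neg (by simp), zero_add, mul_comm]
    congr 1
    have : ∀ s : ℝ, Complex.exp (-(s * a)) * expConvolution (List.replicate (n + 1) a) s =
        ((s ^ n / (n.factorial : ℝ) : ℝ) : ℂ) := fun s => by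
      rw [ih, mul_left_comm, ← Complex.exp_add, neg_add_cancel, Complex.exp_zero]
      push_cast
      ring
    simp only [this]
    rw [intervalIntegral.integral_ofReal, intervalIntegral.integral_div, integral_pow,
      Nat.factorial_succ]
    push_cast
    field_simp
    simp

theorem expConvolution_map_add (c : ℂ) (l : List ℂ) (t : ℝ) :
    expConvolution (l.map (· + c)) t = Complex.exp (t * c) * expConvolution l t := by
  induction l generalizing t with
  | nil => simp [expConvolution]
  | cons a l ih =>
    have : ∀ s : ℝ, Complex.exp (-(s * (a + c))) * expConvolution (l.map (· + c)) s =
        Complex.exp (-(s * a)) * expConvolution l s := fun s => by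
      rw [ih, ← mul_assoc, ← Complex.exp_add]
      ring_nf
    simp only [List.map_cons, expConvolution_cons, this, List.map_eq_nil_iff]
    rw [mul_add (t : ℂ), Complex.exp_add]
    ring

/-- The divided differences of `x ↦ e^{t x}` are convolutions of exponentials. -/
theorem expDividedDifference_eq_expConvolution (t : ℝ) (l : List ℂ) :
    expDividedDifference t l = expConvolution l t := by
  unfold expDividedDifference
  induction hn : l.length using Nat.strong_induction_on generalizing l with
  | _ n ih =>
  subst hn
  cases l with
  | nil => simp [dividedDifference, expConvolution]
  | cons a l =>
    rw [dividedDifference]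
    split_ifs with h
    · obtain ⟨hm, hne⟩ := h.choose_spec
      -- Only membership and `b ≠ a` matter; symmetry of the convolution makes the choice
      -- irrelevant.
      generalize h.choose = b at hm hne
      have hp : l.Perm (b :: l.erase b) := List.perm_cons_erase hm
      have hlen := hp.length_eq
      simp only [List.length_cons] at hlen
      rw [ih _ (by simp) l rfl, ih _ (by simp [hlen]) (a :: l.erase b) rfl,
        expConvolution_perm (hp.cons a), expConvolution_perm hp,
        ← sub_mul_expConvolution, mul_div_cancel_left₀ _ (sub_ne_zero.2 hne)]
    · push Not at h
      rw [List.eq_replicate_of_mem h, ← List.replicate_succ, expConvolution_replicate,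
        List.length_replicate, iteratedDeriv_cexp_const_mul]
      ring

/-- A zero input is an integration. -/
theorem expConvolution_append_zero {l : List ℂ} (hl : l ≠ []) (t : ℝ) :
    expConvolution (l ++ [0]) t = ∫ s in (0 : ℝ)..t, expConvolution l s := by
  rw [expConvolution_perm (List.perm_append_singleton 0 l), expConvolution_cons]
  simp [hl]

end PermExpansion

/-! ### Dyson series of a continuous generator: convergence and evolution equation. -/

namespace PermExpansion

theorem norm_mul_apply_le {Z : Type*} [Fintype Z] {B D : Matrix Z Z ℂ} {b c : ℝ}
    (hb : 0 ≤ b) (hB : ∀ x y, ‖B x y‖ ≤ b)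
    (hD : ∀ x y, ‖D x y‖ ≤ c) (x y : Z) : ‖(B * D) x y‖ ≤ Fintype.card Z * b * c := by
  rw [Matrix.mul_apply]
  refine (norm_sum_le _ _).trans ((Finset.sum_le_sum fun w _ => ?_).trans_eq
    (b := ∑ _w : Z, b * c) ?_)
  · rw [norm_mul]
    exact mul_le_mul (hB x w) (hD w y) (norm_nonneg _) hb
  · simp [mul_assoc]

theorem exists_norm_apply_le {Z : Type*} [Fintype Z] {A : ℝ → Matrix Z Z ℂ}
    (hA : Continuous A) (s R : ℝ) :
    ∃ C, 0 ≤ C ∧ ∀ τ, |τ - s| ≤ R → ∀ x y, ‖A τ x y‖ ≤ C := by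
  have h : ∀ p : Z × Z, ∃ C, ∀ τ ∈ Metric.closedBall s R, ‖A τ p.1 p.2‖ ≤ C := fun p =>
    (isCompact_closedBall s R).exists_bound_of_continuousOn (hA.matrix_elem p.1 p.2).continuousOn
  choose C hC using h
  refine ⟨∑ p, |C p|, Finset.sum_nonneg fun _ _ => abs_nonneg _, fun τ hτ x y => ?_⟩
  refine ((hC (x, y) τ (by simpa [Real.dist_eq] using hτ)).trans (le_abs_self _)).trans ?_
  exact Finset.single_le_sum (f := fun p => |C p|) (fun _ _ => abs_nonneg _)
    (Finset.mem_univ (x, y))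

section Dyson

variable {Z : Type*} [Fintype Z] [DecidableEq Z] {A : ℝ → Matrix Z Z ℂ}

theorem dysonIntegral_succ_apply (A : ℝ → Matrix Z Z ℂ) (s : ℝ) (q : ℕ) (t : ℝ) (x y : Z) :
    dysonIntegral A s (q + 1) t x y = ∫ τ in s..t, (A τ * dysonIntegral A s q τ) x y := rfl

theorem dysonIntegral_succ_self (A : ℝ → Matrix Z Z ℂ) (s : ℝ) (q : ℕ) :
    dysonIntegral A s (q + 1) s = 0 := by
  ext x y
  simp [dysonIntegral_succ_apply]

theorem hasDerivAt_dysonIntegral_succ_of_continuous (hA : Continuous A) {s : ℝ} {q : ℕ}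
    (hq : Continuous (dysonIntegral A s q)) (t : ℝ) (x y : Z) :
    HasDerivAt (fun t => dysonIntegral A s (q + 1) t x y) ((A t * dysonIntegral A s q t) x y) t := by
  have hc : Continuous fun τ => (A τ * dysonIntegral A s q τ) x y :=
    (hA.matrix_mul hq).matrix_elem x y
  exact intervalIntegral.integral_hasDerivAt_right (hc.intervalIntegrable s t)
    (hc.stronglyMeasurableAtFilter _ _) hc.continuousAt

theorem continuous_dysonIntegral (hA : Continuous A) (s : ℝ) (q : ℕ) :
    Continuous (dysonIntegral A s q) := by
  induction q with
  | zero => exact continuous_const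
  | succ q ih =>
    exact continuous_matrix fun x y => continuous_iff_continuousAt.2 fun t =>
      (hasDerivAt_dysonIntegral_succ_of_continuous hA ih t x y).continuousAt

theorem hasDerivAt_dysonIntegral_succ (hA : Continuous A) (s : ℝ) (q : ℕ) (t : ℝ) (x y : Z) :
    HasDerivAt (fun t => dysonIntegral A s (q + 1) t x y) ((A t * dysonIntegral A s q t) x y) t :=
  hasDerivAt_dysonIntegral_succ_of_continuous hA (continuous_dysonIntegral hA s q) t x y

/-- Each product costs `card Z * C`, and integrating `|τ - s|^q` supplies the factor `1/(q+1)` that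
builds the factorial. Absolute values also cover `t < s`. -/
theorem norm_dysonIntegral_le {s R C : ℝ} (hC : 0 ≤ C)
    (hb : ∀ τ, |τ - s| ≤ R → ∀ x y, ‖A τ x y‖ ≤ C) (q : ℕ) {t : ℝ} (ht : |t - s| ≤ R) (x y : Z) :
    ‖dysonIntegral A s q t x y‖ ≤ (Fintype.card Z * C * |t - s|) ^ q / q.factorial := by
  induction q generalizing t x y with
  | zero =>
    simp only [dysonIntegral, Matrix.one_apply]
    split_ifs <;> simp
  | succ q ih =>
    have hbound : ∀ τ ∈ Set.uIoc s t, ‖(A τ * dysonIntegral A s q τ) x y‖ ≤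
        (Fintype.card Z * C) ^ (q + 1) / q.factorial * |τ - s| ^ q := fun τ hτ => by
      have hτR : |τ - s| ≤ R :=
        (Set.abs_sub_left_of_mem_uIcc (Set.uIoc_subset_uIcc hτ)).trans ht
      refine (norm_mul_apply_le hC (hb τ hτR) (fun x y => ih hτR x y) x y).trans_eq ?_
      rw [mul_pow, pow_succ]
      ring
    rw [dysonIntegral_succ_apply]
    refine (intervalIntegral.norm_integral_le_abs_of_norm_le
      (MeasureTheory.ae_restrict_of_forall_mem measurableSet_uIoc hbound)
      (Continuous.intervalIntegrable (by fun_prop) _ _)).trans_eq ?_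
    rw [intervalIntegral.abs_intervalIntegral_eq, MeasureTheory.integral_const_mul,
      integral_pow_abs_sub_uIoc, abs_of_nonneg (by positivity), Nat.factorial_succ, mul_pow _ |t - s|]
    push_cast
    field_simp

theorem summable_dyson_apply (hA : Continuous A) (s t : ℝ) (x y : Z) :
    Summable fun q : ℕ => (-Complex.I) ^ q * dysonIntegral A s q t x y := by
  obtain ⟨C, hC, hb⟩ := exists_norm_apply_le hA s |t - s|
  refine Summable.of_norm_bounded
    (Real.summable_pow_div_factorial (Fintype.card Z * C * |t - s|)) fun q => ?_
  simpa using norm_dysonIntegral_le hC hb q le_rfl x y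

theorem hasSum_timeOrderedExp (hA : Continuous A) (t s : ℝ) :
    HasSum (fun q : ℕ => (-Complex.I) ^ q • dysonIntegral A s q t) (timeOrderedExp A t s) :=
  Summable.hasSum (Pi.summable.2 fun x => Pi.summable.2 fun y => summable_dyson_apply hA s t x y)

theorem hasSum_timeOrderedExp_apply (hA : Continuous A) (t s : ℝ) (x y : Z) :
    HasSum (fun q : ℕ => (-Complex.I) ^ q * dysonIntegral A s q t x y)
      (timeOrderedExp A t s x y) :=
  Pi.hasSum.1 (Pi.hasSum.1 (hasSum_timeOrderedExp hA t s) x) y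

theorem timeOrderedExp_self (A : ℝ → Matrix Z Z ℂ) (s : ℝ) : timeOrderedExp A s s = 1 := by
  rw [timeOrderedExp, tsum_eq_single 0]
  · simp [dysonIntegral]
  · intro q hq
    obtain ⟨q, rfl⟩ := Nat.exists_eq_succ_of_ne_zero hq
    rw [dysonIntegral_succ_self, smul_zero]

theorem hasDerivAt_timeOrderedExp_apply (hA : Continuous A) (s t : ℝ) (x y : Z) :
    HasDerivAt (fun t => timeOrderedExp A t s x y)
      (-Complex.I * (A t * timeOrderedExp A t s) x y) t := by
  -- The extra `1` puts `t` inside the open ball on which the series is differentiated termwise.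
  set R : ℝ := |t - s| + 1
  have hR : 0 ≤ R := by positivity
  obtain ⟨C, hC, hb⟩ := exists_norm_apply_le hA s R
  have hmem : ∀ {τ}, τ ∈ Metric.ball s R → |τ - s| ≤ R := fun h => by
    simpa [Real.dist_eq] using (Metric.mem_ball.1 h).le
  -- The constant term is split off; the derivative of term `q + 1` is then `-i A` times term `q`.
  have htail : ∀ τ, timeOrderedExp A τ s x y = (1 : Matrix Z Z ℂ) x y +
      ∑' q : ℕ, (-Complex.I) ^ (q + 1) * dysonIntegral A s (q + 1) τ x y := fun τ => by
    rw [← (hasSum_timeOrderedExp_apply hA τ s x y).tsum_eq,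
      (summable_dyson_apply hA s τ x y).tsum_eq_zero_add]
    simp [dysonIntegral]
  have hderiv := hasDerivAt_tsum_of_isPreconnected
    (g := fun (q : ℕ) τ => (-Complex.I) ^ (q + 1) * dysonIntegral A s (q + 1) τ x y)
    (g' := fun (q : ℕ) τ => (-Complex.I) ^ (q + 1) * (A τ * dysonIntegral A s q τ) x y)
    (u := fun q : ℕ => Fintype.card Z * C * ((Fintype.card Z * C * R) ^ q / q.factorial))
    (t := Metric.ball s R) (y₀ := t) (y := t)
    ((Real.summable_pow_div_factorial _).mul_left _) Metric.isOpen_ball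
    (convex_ball s R).isPreconnected
    (fun q τ _ => (hasDerivAt_dysonIntegral_succ hA s q τ x y).const_mul _)
    (fun q τ hτ => by
      rw [norm_mul, norm_pow, norm_neg, Complex.norm_I, one_pow, one_mul]
      refine norm_mul_apply_le hC (hb τ (hmem hτ)) (fun x y => ?_) x y
      refine (norm_dysonIntegral_le hC hb q (hmem hτ) x y).trans ?_
      have := hmem hτ
      gcongr)
    (by simp [Real.dist_eq, R])
    ((summable_nat_add_iff 1).2 (summable_dyson_apply hA s t x y))
    (by simp [Real.dist_eq, R])
  simp only [htail]
  refine (hderiv.const_add _).congr_deriv ?_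
  have hs : HasSum (fun q : ℕ => -Complex.I *
      ∑ w, A t x w * ((-Complex.I) ^ q * dysonIntegral A s q t w y))
      (-Complex.I * (A t * timeOrderedExp A t s) x y) := by
    rw [Matrix.mul_apply]
    exact (hasSum_sum fun w _ => (hasSum_timeOrderedExp_apply hA t s w y).mul_left _).mul_left _
  rw [← hs.tsum_eq]
  refine tsum_congr fun q => ?_
  rw [Matrix.mul_apply, Finset.mul_sum, Finset.mul_sum]
  refine Finset.sum_congr rfl fun w _ => ?_
  ring

theorem hasDerivAt_timeOrderedExp_mulVec (hA : Continuous A) (s : ℝ) (ψ : Z → ℂ) (t : ℝ) :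
    HasDerivAt (fun t => timeOrderedExp A t s *ᵥ ψ)
      (-Complex.I • (A t *ᵥ (timeOrderedExp A t s *ᵥ ψ))) t := by
  refine hasDerivAt_pi.2 fun x => ?_
  refine (HasDerivAt.fun_sum fun y _ =>
    (hasDerivAt_timeOrderedExp_apply hA s t x y).mul_const (ψ y)).congr_deriv ?_
  rw [Matrix.mulVec_mulVec, Pi.smul_apply, Matrix.mulVec, dotProduct, smul_eq_mul, Finset.mul_sum]
  exact Finset.sum_congr rfl fun y _ => mul_assoc _ _ _

theorem hasSum_timeOrderedExp_mulVec (hA : Continuous A) (t s : ℝ) (ψ : Z → ℂ) :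
    HasSum (fun q : ℕ => (-Complex.I) ^ q • (dysonIntegral A s q t *ᵥ ψ))
      (timeOrderedExp A t s *ᵥ ψ) := by
  refine Pi.hasSum.2 fun x => ?_
  have h := hasSum_sum (s := Finset.univ) fun y _ =>
    (hasSum_timeOrderedExp_apply hA t s x y).mul_right (ψ y)
  refine h.congr_fun fun q => ?_
  simp [Matrix.mulVec, dotProduct, Finset.mul_sum, mul_assoc]

end Dyson

end PermExpansion

/-! ### Words of permutations and their coefficients. -/

namespace PermExpansion

theorem permOp_mulVec_ket {Z : Type*} [Fintype Z] [DecidableEq Z] (σ : Equiv.Perm Z) (z : Z) :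
    permOp σ *ᵥ ket z = ket (σ z) := by
  ext x
  simp [permOp, ket, Pi.single_apply]

namespace ExpSumHamiltonian

variable {Z : Type*} {M K : ℕ} (H : ExpSumHamiltonian Z M K)

section Words

variable {q : ℕ} (i : Fin q → Fin (M + 1)) (k : Fin q → Fin K) (a : Fin (M + 1)) (b : Fin K)
  (z : Z)

theorem label_zero : H.label i z 0 = z := by
  simp [label]

theorem ofFn_snoc {α : Type*} {n : ℕ} (f : Fin n → α) (a : α) :
    List.ofFn (Fin.snoc f a : Fin (n + 1) → α) = List.ofFn f ++ [a] := by
  rw [List.ofFn_succ', List.concat_eq_append]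
  simp only [Fin.snoc_castSucc, Fin.snoc_last]

theorem label_snoc_of_le {j : ℕ} (hj : j ≤ q) :
    H.label (Fin.snoc i a : Fin (q + 1) → Fin (M + 1)) z j = H.label i z j := by
  rw [label, label, ofFn_snoc, List.take_append_of_le_length (by simpa using hj)]

theorem label_snoc_last :
    H.label (Fin.snoc i a : Fin (q + 1) → Fin (M + 1)) z (q + 1) = H.P a (H.label i z q) := by
  rw [label, label, ofFn_snoc, List.take_of_length_le (by simp),
    List.take_of_length_le (l := List.ofFn i) (by simp), List.foldl_append]
  rfl

theorem opWord_mulVec_ket [Fintype Z] [DecidableEq Z] :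
    H.opWord i *ᵥ ket z = ket (H.label i z q) := by
  induction q with
  | zero => simp [opWord, label]
  | succ q ih =>
    rw [← Fin.snoc_init_self i, label_snoc_last, ← permOp_mulVec_ket, ← ih, Matrix.mulVec_mulVec]
    congr 1
    rw [opWord, opWord, List.ofFn_succ', List.concat_eq_append, List.reverse_append]
    simp only [List.reverse_singleton, List.singleton_append, List.prod_cons, Fin.snoc_castSucc,
      Fin.snoc_last]

theorem lamAt_snoc_castSucc (l : Fin q) :
    H.lamAt (Fin.snoc i a : Fin (q + 1) → _) (Fin.snoc k b : Fin (q + 1) → _) z l.castSucc =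
      H.lamAt i k z l := by
  simp [lamAt, label_snoc_of_le H i a z (Nat.succ_le_of_lt l.isLt)]

theorem lamAt_snoc_last :
    H.lamAt (Fin.snoc i a : Fin (q + 1) → _) (Fin.snoc k b : Fin (q + 1) → _) z (Fin.last q) =
      H.lam a b (H.P a (H.label i z q)) := by
  simp [lamAt, label_snoc_last]

theorem dWord_snoc :
    H.dWord (Fin.snoc i a : Fin (q + 1) → _) (Fin.snoc k b : Fin (q + 1) → _) z =
      H.dWord i k z * H.d a b (H.P a (H.label i z q)) := by
  rw [dWord, Fin.prod_univ_castSucc, dWord]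
  congr 1
  · refine Finset.prod_congr rfl fun l _ => ?_
    simp [label_snoc_of_le H i a z (Nat.succ_le_of_lt l.isLt)]
  · simp [label_snoc_last]

/-- The rate at which the phase of the transition `y ↦ P_a y` in `H_I` grows. -/
def rate (a : Fin (M + 1)) (b : Fin K) (y : Z) : ℂ :=
  Complex.I * ((H.E (H.P a y) : ℂ) - H.E y) + H.lam a b (H.P a y)

theorem dWordAt_snoc (t : ℝ) :
    H.dWordAt (Fin.snoc i a : Fin (q + 1) → _) (Fin.snoc k b : Fin (q + 1) → _) z t =
      H.dWordAt i k z t * (H.d a b (H.P a (H.label i z q)) *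
        Complex.exp (t * H.lam a b (H.P a (H.label i z q)))) := by
  rw [dWordAt, dWordAt, dWord_snoc, Fin.sum_univ_castSucc, lamAt_snoc_last, mul_add,
    Complex.exp_add]
  simp only [lamAt_snoc_castSucc]
  ring

theorem input_snoc_castSucc (j : Fin q) :
    H.input (Fin.snoc i a : Fin (q + 1) → _) (Fin.snoc k b : Fin (q + 1) → _) z j.castSucc =
      H.input i k z j + H.rate a b (H.label i z q) := by
  rw [input, input, rate, label_snoc_last, Fin.val_castSucc, label_snoc_of_le H i a z j.isLt.le,
    Finset.sum_filter, Finset.sum_filter, Fin.sum_univ_castSucc, lamAt_snoc_last]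
  simp only [lamAt_snoc_castSucc, Fin.castSucc_le_castSucc_iff, Fin.le_last, if_true]
  ring

theorem input_snoc_last :
    H.input (Fin.snoc i a : Fin (q + 1) → _) (Fin.snoc k b : Fin (q + 1) → _) z (Fin.last q) =
      H.rate a b (H.label i z q) := by
  rw [input, rate, label_snoc_last, Fin.val_last, label_snoc_of_le H i a z le_rfl,
    Finset.sum_filter, Fin.sum_univ_castSucc, lamAt_snoc_last]
  simp

/-- A new last letter raises the final energy and every tail sum, so all old inputs shift by the
same `rate`; the trailing `0` of the old divided difference becomes the new last input. -/
theorem ofFn_input_snoc :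
    List.ofFn (H.input (Fin.snoc i a : Fin (q + 1) → _) (Fin.snoc k b : Fin (q + 1) → _) z) =
      (List.ofFn (H.input i k z) ++ [0]).map (· + H.rate a b (H.label i z q)) := by
  rw [List.ofFn_succ', List.concat_eq_append, input_snoc_last, List.map_append, List.map_ofFn]
  simp only [input_snoc_castSucc, List.map_cons, List.map_nil, zero_add]
  rfl

/-- The coefficient of `P_{𝐢_q}|z⟩` in the `q`-th iterated integral of `H_I` over `[s, t]`. -/
noncomputable def coeff (s t : ℝ) : ℂ :=
  Complex.exp (-Complex.I * s * ((H.E z : ℂ) - H.E (H.label i z q))) *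
    expDividedDifference (t - s) (List.ofFn (H.input i k z) ++ [0]) * H.dWordAt i k z s

theorem continuous_coeff (s : ℝ) : Continuous (H.coeff i k z s) := by
  have := continuous_expConvolution (List.ofFn (H.input i k z) ++ [0])
  unfold coeff
  simp only [expDividedDifference_eq_expConvolution]
  fun_prop

/-- The trailing `0` turns the divided difference into an integral over `[0, t - s]`, the common
shift comes out as an exponential, and substituting `τ - s` moves the integral to `[s, t]`. -/
theorem coeff_snoc (s t : ℝ) :
    H.coeff (Fin.snoc i a : Fin (q + 1) → _) (Fin.snoc k b : Fin (q + 1) → _) z s t =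
      ∫ τ in s..t, H.coeff i k z s τ * (H.d a b (H.P a (H.label i z q)) *
        Complex.exp (τ * H.rate a b (H.label i z q))) := by
  have hint : expDividedDifference (t - s) (List.ofFn (H.input (Fin.snoc i a : Fin (q + 1) → _)
      (Fin.snoc k b : Fin (q + 1) → _) z) ++ [0]) =
      ∫ τ in s..t, Complex.exp ((τ - s : ℝ) * H.rate a b (H.label i z q)) *
        expDividedDifference (τ - s) (List.ofFn (H.input i k z) ++ [0]) := by
    simp only [expDividedDifference_eq_expConvolution]
    rw [expConvolution_append_zero (by simp), ofFn_input_snoc]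
    simp only [expConvolution_map_add]
    rw [intervalIntegral.integral_comp_sub_right (fun σ : ℝ => Complex.exp
      (σ * H.rate a b (H.label i z q)) * expConvolution (List.ofFn (H.input i k z) ++ [0]) σ),
      sub_self]
  rw [coeff, hint, ← intervalIntegral.integral_const_mul, ← intervalIntegral.integral_mul_const]
  refine intervalIntegral.integral_congr fun τ _ => ?_
  simp only [coeff, dWordAt_snoc, label_snoc_last]
  -- The exponential based at `s` is rebased at `0`: the surplus `e^{-s * rate}` is absorbed by the
  -- phase and by the new factor of `dWordAt`.
  have hexp : Complex.exp (-Complex.I * s * ((H.E z : ℂ) - H.E (H.P a (H.label i z q)))) *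
      Complex.exp ((τ - s : ℝ) * H.rate a b (H.label i z q)) *
      Complex.exp (s * H.lam a b (H.P a (H.label i z q))) =
      Complex.exp (-Complex.I * s * ((H.E z : ℂ) - H.E (H.label i z q))) *
        Complex.exp (τ * H.rate a b (H.label i z q)) := by
    simp only [← Complex.exp_add, rate]
    congr 1
    push_cast
    ring
  linear_combination (expDividedDifference (τ - s) (List.ofFn (H.input i k z) ++ [0]) *
    H.dWordAt i k z s * H.d a b (H.P a (H.label i z q))) * hexp

end Words

theorem sum_snoc {α : Type*} [Fintype α] {n : ℕ} {E : Type*} [AddCommMonoid E]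
    (f : (Fin (n + 1) → α) → E) :
    ∑ i, f i = ∑ i : Fin n → α, ∑ a : α, f (Fin.snoc i a) := by
  rw [← (Fin.snocEquiv fun _ => α).sum_comp, Fintype.sum_prod_type_right]
  rfl

/-! ### Matrix elements of `H_I` and the Dyson terms on basis vectors. -/

variable [Fintype Z] [DecidableEq Z]

theorem exp_smul_diagonal (c : ℂ) (v : Z → ℂ) :
    NormedSpace.exp (c • Matrix.diagonal v) =
      Matrix.diagonal fun x => Complex.exp (c * v x) := by
  rw [← Matrix.diagonal_smul, Matrix.exp_diagonal]
  congr 1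
  ext x
  simp [Pi.coe_exp, Complex.exp_eq_exp_ℂ]

theorem HI_apply (t : ℝ) (x y : Z) :
    H.HI t x y = ∑ a : Fin (M + 1), ∑ b : Fin K, if x = H.P a y then
      H.d a b (H.P a y) * Complex.exp (t * H.rate a b y) else 0 := by
  simp only [HI, V, D, H0, exp_smul_diagonal, Matrix.diagonal_mul_diagonal, Matrix.mul_diagonal,
    Matrix.diagonal_mul, Matrix.sum_apply, Finset.sum_mul, Finset.mul_sum, permOp, Matrix.of_apply]
  refine Finset.sum_congr rfl fun a _ => Finset.sum_congr rfl fun b _ => ?_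
  split_ifs with h
  · subst h
    have : Complex.exp (t * H.rate a b y) = Complex.exp (Complex.I * t * H.E (H.P a y)) *
        Complex.exp (t * H.lam a b (H.P a y)) * Complex.exp (-Complex.I * t * H.E y) := by
      simp only [← Complex.exp_add, rate]
      congr 1
      ring
    rw [this]
    ring
  · simp

theorem continuous_HI : Continuous H.HI := by
  refine continuous_matrix fun x y => ?_
  simp only [HI_apply]
  refine continuous_finsetSum _ fun a _ => continuous_finsetSum _ fun b _ => ?_
  split_ifs <;> fun_prop

theorem HI_mulVec_ket (t : ℝ) (y : Z) :
    H.HI t *ᵥ ket y = ∑ a : Fin (M + 1), ∑ b : Fin K,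
      (H.d a b (H.P a y) * Complex.exp (t * H.rate a b y)) • ket (H.P a y) := by
  ext x
  simp [ket, HI_apply, Finset.sum_apply, Pi.single_apply]

/-- The outermost factor `H_I(τ)` acts last, so it appends the last letter of the word, and
integrating over `τ` is `coeff_snoc`. -/
theorem dysonIntegral_HI_mulVec_ket (s : ℝ) (z : Z) (q : ℕ) (t : ℝ) :
    dysonIntegral H.HI s q t *ᵥ ket z =
      ∑ i : Fin q → Fin (M + 1), ∑ k : Fin q → Fin K,
        H.coeff i k z s t • ket (H.label i z q) := by
  induction q generalizing t with
  | zero =>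
    simp [dysonIntegral, coeff, label_zero, expDividedDifference_eq_expConvolution,
      expConvolution_singleton, dWordAt, dWord]
  | succ q ih =>
    have hint : ∀ τ, (H.HI τ * dysonIntegral H.HI s q τ) *ᵥ ket z =
        ∑ i : Fin q → Fin (M + 1), ∑ a, ∑ k : Fin q → Fin K, ∑ b,
          (H.coeff i k z s τ * (H.d a b (H.P a (H.label i z q)) *
            Complex.exp (τ * H.rate a b (H.label i z q)))) • ket (H.P a (H.label i z q)) :=
      fun τ => by
        rw [← Matrix.mulVec_mulVec, ih]
        simp only [Matrix.mulVec_sum, Matrix.mulVec_smul, HI_mulVec_ket, Finset.smul_sum, smul_smul]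
        -- The order `i, a, k, b` is the one produced by splitting both multi-indices with
        -- `sum_snoc`.
        exact Finset.sum_congr rfl fun i _ => Finset.sum_comm
    ext x
    -- Passing between column `z` and the action on `|z⟩` lets the entrywise integral act on
    -- vectors.
    have hx : ∀ (B : Matrix Z Z ℂ), (B *ᵥ ket z) x = B x z := fun B => by simp [ket]
    rw [hx, dysonIntegral_succ_apply]
    simp only [← hx, hint, Finset.sum_apply, Pi.smul_apply, smul_eq_mul]
    have hc : ∀ (i : Fin q → Fin (M + 1)) (a) (k : Fin q → Fin K) (b), Continuous fun τ : ℝ =>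
        H.coeff i k z s τ * (H.d a b (H.P a (H.label i z q)) *
          Complex.exp (τ * H.rate a b (H.label i z q))) * ket (H.P a (H.label i z q)) x :=
      fun i a k b => by
        have := H.continuous_coeff i k z s
        fun_prop
    rw [intervalIntegral.integral_finsetSum fun i _ => Continuous.intervalIntegrable
      (continuous_finsetSum _ fun a _ => continuous_finsetSum _ fun k _ =>
        continuous_finsetSum _ fun b _ => hc i a k b) _ _, sum_snoc]
    refine Finset.sum_congr rfl fun i _ => ?_
    rw [intervalIntegral.integral_finsetSum fun a _ => Continuous.intervalIntegrable
      (continuous_finsetSum _ fun k _ => continuous_finsetSum _ fun b _ => hc i a k b) _ _]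
    refine Finset.sum_congr rfl fun a _ => ?_
    rw [intervalIntegral.integral_finsetSum fun k _ => Continuous.intervalIntegrable
      (continuous_finsetSum _ fun b _ => hc i a k b) _ _, sum_snoc]
    refine Finset.sum_congr rfl fun k _ => ?_
    rw [intervalIntegral.integral_finsetSum fun b _ => (hc i a k b).intervalIntegrable _ _]
    refine Finset.sum_congr rfl fun b _ => ?_
    rw [intervalIntegral.integral_mul_const, coeff_snoc, label_snoc_last]

end ExpSumHamiltonian

end PermExpansion

theorem mainTheorem6 {Z : Type*} [Fintype Z] [DecidableEq Z] {M K : ℕ}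
    (H : PermExpansion.ExpSumHamiltonian Z M K) (tw dt : ℝ) :
    (H.UI tw tw = 1 ∧
      ∀ (ψ : Z → ℂ) (t : ℝ),
        HasDerivAt (fun τ : ℝ => H.UI τ tw *ᵥ ψ)
          (-Complex.I • (H.HI t *ᵥ (H.UI t tw *ᵥ ψ))) t) ∧
    ∀ z : Z,
      HasSum
        (fun q : ℕ =>
          ∑ i : Fin q → Fin (M + 1), ∑ k : Fin q → Fin K,
            ((-Complex.I) ^ q *
              Complex.exp (-Complex.I * tw * ((H.E z : ℂ) - H.E (H.label i z q))) *
              PermExpansion.expDividedDifference dt (List.ofFn (H.input i k z) ++ [0]) *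
              H.dWordAt i k z tw) •
            (H.opWord i *ᵥ PermExpansion.ket z))
        (H.UI (tw + dt) tw *ᵥ PermExpansion.ket z) := by
  refine ⟨⟨PermExpansion.timeOrderedExp_self _ _, fun ψ t =>
    PermExpansion.hasDerivAt_timeOrderedExp_mulVec H.continuous_HI tw ψ t⟩, fun z => ?_⟩
  refine (PermExpansion.hasSum_timeOrderedExp_mulVec H.continuous_HI (tw + dt) tw
    (PermExpansion.ket z)).congr_fun fun q => ?_
  rw [H.dysonIntegral_HI_mulVec_ket, Finset.smul_sum]
  refine Finset.sum_congr rfl fun i _ => ?_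
  rw [Finset.smul_sum]
  refine Finset.sum_congr rfl fun k _ => ?_
  rw [smul_smul, H.opWord_mulVec_ket, PermExpansion.ExpSumHamiltonian.coeff, add_sub_cancel_left]
  congr 1
  ring
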